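/- Let $0<T_1<T_2<T_3<\cdots$ be the points of a Poisson process on the positive real line with constant intensity $\tfrac12$. For $V\ge 0$ let $N(V)=2\cdot\#\{j\ge 1: T_j\le V\}$ and $R(V)=N(V)-V$. For $c\in(\tfrac14,\tfrac12)$ put $$H(c)=\int_0^\infty V^{-2c}\,dR(V)=\lim_{A\to\infty}\Big(2\sum_{T_j\le A}T_j^{-2c}-\int_0^A V^{-2c}\,dV\Big).$$ Almost surely, this limit exists in $\mathbb R$ for every $c\in(\tfrac14,\tfrac12)$. For $\tfrac14<c_1<c_2\le\tfrac12$ let $$f(c_1,c_2)=\mathrm{Prob}\big\{H(c)<0\ \text{ for all } c\in[c_1,c_2]\setminus\{\tfrac12\}\big\}.$$ Then for each fixed $c_2\in(\tfrac14,\tfrac12]$, $$\lim_{c_1\to\frac14+} f(c_1,c_2)=0.$$ -/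

import Mathlib

open MeasureTheory ProbabilityTheory Filter Topology Set
open scoped NNReal

namespace EpsteinPoisson

variable {Ω : Type*}

/-- The number of points `T j ω` that are at most `V`. -/
noncomputable def count (T : ℕ → Ω → ℝ) (V : ℝ≥0) (ω : Ω) : ℕ :=
  {j : ℕ | T j ω ≤ V}.ncard

/-- `T 0 < T 1 < T 2 < …` are the points, in increasing order, of a Poisson process on the
positive real line with constant intensity `r`: almost surely the points are positive, strictly
increasing and tend to infinity (so that bounded intervals contain finitely many of them), and
the counting process `V ↦ count T V` has independent increments, the increment over `(s, t]`
being Poisson distributed with mean `r * (t - s)`. -/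
structure IsPoissonPoints [MeasurableSpace Ω] (P : Measure Ω) (r : ℝ≥0) (T : ℕ → Ω → ℝ) :
    Prop where
  measurable : ∀ j, Measurable (T j)
  pos : ∀ᵐ ω ∂P, ∀ j, 0 < T j ω
  strictMono : ∀ᵐ ω ∂P, StrictMono fun j => T j ω
  tendsto_atTop : ∀ᵐ ω ∂P, Tendsto (fun j => T j ω) atTop atTop
  hasIndepIncrements : HasIndepIncrements (count T) P
  hasLaw_increment : ∀ s t : ℝ≥0, s ≤ t →
    HasLaw (fun ω => count T t ω - count T s ω) (poissonMeasure (r * (t - s))) P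

/-- The Stieltjes measure `dN` of `N(V) = 2 * count T V`: a mass `2` at every point `T j ω`. -/
noncomputable def dN (T : ℕ → Ω → ℝ) (ω : Ω) : Measure ℝ :=
  (2 : ℝ≥0) • Measure.sum fun j => Measure.dirac (T j ω)

/-- The truncated integral `∫_0^A V^(-2c) dR(V)`, where `R(V) = N(V) - V`, that is,
`dR(V) = dN(V) - dV`. -/
noncomputable def truncIntegral (T : ℕ → Ω → ℝ) (c A : ℝ) (ω : Ω) : ℝ :=
  (∫ V in Ioc 0 A, V ^ (-2 * c) ∂(dN T ω)) - ∫ V in Ioc 0 A, V ^ (-2 * c)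

/-- The improper integral `H(c) = ∫_0^∞ V^(-2c) dR(V)`, the limit of the truncated integrals
(with an unspecified value at those `ω` where the integral diverges). -/
noncomputable def H (T : ℕ → Ω → ℝ) (c : ℝ) (ω : Ω) : ℝ :=
  limUnder atTop fun A : ℝ => truncIntegral T c A ω

/-- The probability `f(c₁, c₂)` that `H(c) < 0` for all `c ∈ [c₁, c₂]` other than `1/2`. -/
noncomputable def f [MeasurableSpace Ω] (P : Measure Ω) (T : ℕ → Ω → ℝ) (c₁ c₂ : ℝ) : ℝ :=
  P.real {ω | ∀ c ∈ Icc c₁ c₂ \ {1 / 2}, H T c ω < 0}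

end EpsteinPoisson

/-! The increments `X_k` of `R` over `(k+1, k+2]` are i.i.d., centred and non-degenerate, with
finite fourth moments. Freezing the kernel at the left end of each unit interval turns `H(c)` into
the random Dirichlet series `∑ (k+1)^(-2c) X_k`. The remaining error is summable and bounded
independently of `c`, and the part of the integral over `(0, 1]` is bounded below near `c = 1/4`
(`exists_tendsto_truncIntegral`).

The series converges for `2c > 1/2`, but its variance is a multiple of `∑ (k+1)^(-4c)`, which blows
up as `c → 1/4`. Comparable second and fourth moments make large positive values likely with
probability bounded below (`exists_le_measureReal_lt`). Unboundedness above is a tail event, so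
Kolmogorov's law makes it almost sure (`IsNoise.ae_forall_exists_lt`). Hence `H` is almost surely
nonnegative at points of a deterministic sequence arbitrarily close to `1/4`, and `f` is dominated
by probabilities of events decreasing to a null set. -/

namespace EpsteinPoisson

variable {Ω : Type*}

/-- Independent centred random variables with common variance `b` and fourth moments at
most `K`. -/
structure IsNoise [MeasurableSpace Ω] (P : Measure Ω) (b K : ℝ) (Y : ℕ → Ω → ℝ) : Prop where
  measurable : ∀ k, Measurable (Y k)
  indep : iIndepFun Y P
  memLp : ∀ k, MemLp (Y k) 4 P
  mean : ∀ k, ∫ ω, Y k ω ∂P = 0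
  sq : ∀ k, ∫ ω, Y k ω ^ 2 ∂P = b
  fourth : ∀ k, ∫ ω, Y k ω ^ 4 ∂P ≤ K

/-! ### Second and fourth moments of weighted sums; a one-sided Paley–Zygmund bound -/

section Moments

variable [MeasurableSpace Ω] {P : Measure Ω}

lemma integrable_pow_of_memLp_four [IsProbabilityMeasure P] {X : Ω → ℝ} (hX : MemLp X 4 P) {i : ℕ} (hi : i ≤ 4) :
    Integrable (fun ω => X ω ^ i) P := by
  have h : MemLp X (i : ENNReal) P := hX.mono_exponent (by exact_mod_cast hi)
  have := h.integrable_norm_pow'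
  refine this.mono' (hX.1.pow i) (ae_of_all _ fun ω => ?_)
  simp

lemma integral_add_sq_of_indep [IsProbabilityMeasure P] {X Z : Ω → ℝ} (hX : MemLp X 4 P) (hZ : MemLp Z 4 P)
    (h : IndepFun X Z P) (hX1 : ∫ ω, X ω ∂P = 0) :
    ∫ ω, (X ω + Z ω) ^ 2 ∂P = ∫ ω, X ω ^ 2 ∂P + ∫ ω, Z ω ^ 2 ∂P := by
  have i1 := integrable_pow_of_memLp_four hX (i := 1) (by norm_num)
  have i2 := integrable_pow_of_memLp_four hX (i := 2) (by norm_num)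
  have j1 := integrable_pow_of_memLp_four hZ (i := 1) (by norm_num)
  have j2 := integrable_pow_of_memLp_four hZ (i := 2) (by norm_num)
  simp only [pow_one] at i1 j1
  have e : ∀ ω, (X ω + Z ω) ^ 2 = X ω ^ 2 + Z ω ^ 2 + 2 * (X ω * Z ω) := fun ω => by ring
  have m : Integrable (fun ω => X ω * Z ω) P := h.integrable_mul i1 j1
  simp_rw [e]
  rw [integral_add (i2.fun_add j2) (m.const_mul 2), integral_add i2 j2, integral_const_mul,
    h.integral_fun_mul_eq_mul_integral hX.1 hZ.1, hX1]
  simp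

lemma integral_add_pow_four_of_indep [IsProbabilityMeasure P] {X Z : Ω → ℝ} (hX : MemLp X 4 P) (hZ : MemLp Z 4 P)
    (h : IndepFun X Z P) (hX1 : ∫ ω, X ω ∂P = 0) (hZ1 : ∫ ω, Z ω ∂P = 0) :
    ∫ ω, (X ω + Z ω) ^ 4 ∂P = ∫ ω, X ω ^ 4 ∂P
      + 6 * ((∫ ω, X ω ^ 2 ∂P) * ∫ ω, Z ω ^ 2 ∂P) + ∫ ω, Z ω ^ 4 ∂P := by
  have hp (i j : ℕ) : IndepFun (fun ω => X ω ^ i) (fun ω => Z ω ^ j) P :=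
    h.comp (φ := fun x : ℝ => x ^ i) (ψ := fun x : ℝ => x ^ j)
      (measurable_id.pow_const i) (measurable_id.pow_const j)
  have iX {i : ℕ} (hi : i ≤ 4) := integrable_pow_of_memLp_four hX hi
  have iZ {i : ℕ} (hi : i ≤ 4) := integrable_pow_of_memLp_four hZ hi
  have m {i j : ℕ} (hi : i ≤ 4) (hj : j ≤ 4) : Integrable (fun ω => X ω ^ i * Z ω ^ j) P :=
    (hp i j).integrable_mul (iX hi) (iZ hj)
  have im (i j : ℕ) : ∫ ω, X ω ^ i * Z ω ^ j ∂P = (∫ ω, X ω ^ i ∂P) * ∫ ω, Z ω ^ j ∂P :=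
    (hp i j).integral_fun_mul_eq_mul_integral (hX.1.pow i) (hZ.1.pow j)
  have e : ∀ ω, (X ω + Z ω) ^ 4 = X ω ^ 4 + (4 * (X ω ^ 3 * Z ω ^ 1) + (6 * (X ω ^ 2 * Z ω ^ 2)
      + (4 * (X ω ^ 1 * Z ω ^ 3) + Z ω ^ 4))) := fun ω => by ring
  have m31 := (m (i := 3) (j := 1) (by norm_num) (by norm_num)).const_mul 4
  have m22 := (m (i := 2) (j := 2) (by norm_num) (by norm_num)).const_mul 6
  have m13 := (m (i := 1) (j := 3) (by norm_num) (by norm_num)).const_mul 4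
  have m4 := iZ le_rfl
  have m40 := iX le_rfl
  simp_rw [e]
  rw [integral_add m40 (m31.fun_add (m22.fun_add (m13.fun_add m4))),
    integral_add m31 (m22.fun_add (m13.fun_add m4)), integral_add m22 (m13.fun_add m4), integral_add m13 m4]
  simp only [integral_const_mul, im]
  simp only [pow_one, hX1, hZ1]
  ring

variable {b K : ℝ} {Y : ℕ → Ω → ℝ}

lemma IsNoise.memLp_sum (h : IsNoise P b K Y) (a : ℕ → ℝ) (n : ℕ) :
    MemLp (fun ω => ∑ k ∈ Finset.range n, a k * Y k ω) 4 P :=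
  memLp_finsetSum _ fun k _ => (h.memLp k).const_mul (a k)

lemma IsNoise.integral_sum [IsProbabilityMeasure P] (h : IsNoise P b K Y) (a : ℕ → ℝ) (n : ℕ) :
    ∫ ω, ∑ k ∈ Finset.range n, a k * Y k ω ∂P = 0 := by
  rw [integral_finsetSum _ fun k _ => ((h.memLp k).integrable (by norm_num)).const_mul (a k)]
  simp [integral_const_mul, h.mean]

lemma IsNoise.indepFun_sum (h : IsNoise P b K Y) (a : ℕ → ℝ) (n : ℕ) :
    IndepFun (fun ω => ∑ k ∈ Finset.range n, a k * Y k ω) (fun ω => a n * Y n ω) P := by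
  have h1 : iIndepFun (fun k ω => a k * Y k ω) P :=
    h.indep.comp (fun k x => a k * x) fun k => measurable_const_mul (a k)
  have := h1.indepFun_finsetSum_of_notMem (fun k => (h.measurable k).const_mul (a k))
    (s := Finset.range n) (i := n) (by simp)
  convert this using 1
  ext ω
  simp

lemma IsNoise.integral_sum_sq [IsProbabilityMeasure P] (h : IsNoise P b K Y) (a : ℕ → ℝ) (n : ℕ) :
    ∫ ω, (∑ k ∈ Finset.range n, a k * Y k ω) ^ 2 ∂P = b * ∑ k ∈ Finset.range n, a k ^ 2 := by
  induction n with
  | zero => simp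
  | succ n ih =>
    simp_rw [Finset.sum_range_succ]
    rw [integral_add_sq_of_indep (h.memLp_sum a n) ((h.memLp n).const_mul (a n))
      (h.indepFun_sum a n) (h.integral_sum a n), ih]
    simp_rw [mul_pow]
    rw [integral_const_mul, h.sq]
    ring

/-- With `v` the sum of squares so far, a new term `a` adds at most `6b²va² + Ka⁴`, which is
absorbed by the increase `(3b² + K)(2va² + a⁴)` of the right side. -/
lemma IsNoise.integral_sum_pow_four_le [IsProbabilityMeasure P] (h : IsNoise P b K Y) (a : ℕ → ℝ) (n : ℕ) :
    ∫ ω, (∑ k ∈ Finset.range n, a k * Y k ω) ^ 4 ∂P ≤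
      (3 * b ^ 2 + K) * (∑ k ∈ Finset.range n, a k ^ 2) ^ 2 := by
  have hK : 0 ≤ K := (integral_nonneg fun ω => by positivity).trans (h.fourth 0)
  induction n with
  | zero => simp
  | succ n ih =>
    simp_rw [Finset.sum_range_succ]
    have hv : 0 ≤ ∑ k ∈ Finset.range n, a k ^ 2 := Finset.sum_nonneg fun k _ => sq_nonneg _
    have hY1 : ∫ ω, a n * Y n ω ∂P = 0 := by rw [integral_const_mul, h.mean, mul_zero]
    rw [integral_add_pow_four_of_indep (h.memLp_sum a n) ((h.memLp n).const_mul (a n))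
      (h.indepFun_sum a n) (h.integral_sum a n) hY1, h.integral_sum_sq]
    simp_rw [mul_pow]
    rw [integral_const_mul, integral_const_mul, h.sq]
    have h4 : a n ^ 4 * ∫ ω, Y n ω ^ 4 ∂P ≤ a n ^ 4 * K := by gcongr; exact h.fourth n
    set v := ∑ k ∈ Finset.range n, a k ^ 2
    nlinarith [mul_nonneg (mul_nonneg hK hv) (sq_nonneg (a n)), sq_nonneg (b * a n ^ 2)]

/-- A centred random variable whose fourth moment is controlled by its variance exceeds a fixed
fraction of its standard deviation with probability bounded from below. -/
lemma exists_le_measureReal_lt [IsProbabilityMeasure P] {K : ℝ} (hK : 1 ≤ K) :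
    ∃ ε > 0, ∃ δ > 0, ∀ (X : Ω → ℝ) (v : ℝ), 0 < v → MemLp X 4 P → Measurable X →
      ∫ ω, X ω ∂P = 0 → ∫ ω, X ω ^ 2 ∂P = v → ∫ ω, X ω ^ 4 ∂P ≤ K * v ^ 2 →
      δ ≤ P.real {ω | ε * √v < X ω} := by
  refine ⟨1 / (16 * K), by positivity, K / 2 / (4 * K ^ 2 + 9 * K ^ 4), by positivity, ?_⟩
  intro X v hv hX hXm h1 h2 h4
  set A : Set Ω := {ω | 1 / (16 * K) * √v < X ω}
  have hA : MeasurableSet A := measurableSet_lt measurable_const hXm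
  have hs : 0 < √v := Real.sqrt_pos.2 hv
  have hs2 : √v ^ 2 = v := Real.sq_sqrt hv.le
  -- The test polynomial `4K²t + 2Kt² - t⁴` has mean at least `2K - K = K` at `t = X/√v`. It is at
  -- most `K/2` for `t ≤ 1/(16K)`, the linear term ensuring this for negative `t`, and it is bounded
  -- everywhere. So the event `t > 1/(16K)` must carry at least `K/2` of the mean.
  have key : ∀ t : ℝ, 4 * K ^ 2 * t + 2 * K * t ^ 2 - t ^ 4 ≤ 4 * K ^ 2 + 9 * K ^ 4 := by
    intro t
    nlinarith [sq_nonneg (t ^ 2 - 3 * K ^ 2), mul_nonneg (sq_nonneg K) (sq_nonneg (t - 1)),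
      mul_nonneg (mul_nonneg (by linarith : 0 ≤ K) (by linarith : 0 ≤ K - 1)) (sq_nonneg t),
      mul_nonneg (sq_nonneg K) (sq_nonneg t), mul_nonneg (sq_nonneg K) (sq_nonneg (t + 1)), sq_nonneg K]
  have key' : ∀ t : ℝ, t ≤ 1 / (16 * K) → 4 * K ^ 2 * t + 2 * K * t ^ 2 - t ^ 4 ≤ K / 2 := by
    intro t ht
    rcases le_or_gt 0 t with h0 | h0
    · have hKt : K * t ≤ 1 / 16 := by
        calc K * t ≤ K * (1 / (16 * K)) := by gcongr
          _ = 1 / 16 := by field_simp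
      have : 0 ≤ K * t := by positivity
      have ht1 : t ≤ 1 := by nlinarith
      nlinarith [sq_nonneg (t ^ 2), mul_nonneg this h0]
    · set u := -t with hu
      have hu0 : 0 < u := by linarith
      have e : 4 * K ^ 2 * t + 2 * K * t ^ 2 - t ^ 4 = u * (2 * K * u - 4 * K ^ 2 - u ^ 3) := by
        rw [hu]; ring
      have : 2 * K * u - 4 * K ^ 2 - u ^ 3 ≤ 0 := by
        rcases le_or_gt (2 * K) (u ^ 2) with h3 | h3
        · nlinarith [sq_nonneg K]
        · have : u ≤ 2 * K := by nlinarith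
          nlinarith [pow_pos hu0 3]
      rw [e]
      nlinarith
  have pw : ∀ ω, 4 * K ^ 2 * (X ω / √v) + 2 * K * (X ω / √v) ^ 2 - (X ω / √v) ^ 4 ≤
      K / 2 + A.indicator (fun _ => 4 * K ^ 2 + 9 * K ^ 4) ω := by
    intro ω
    by_cases hω : ω ∈ A
    · rw [indicator_of_mem hω]
      linarith [key (X ω / √v)]
    · rw [indicator_of_notMem hω, add_zero]
      exact key' _ ((div_le_iff₀ hs).2 (not_lt.1 hω))
  have i1 : Integrable (fun ω => 4 * K ^ 2 * (X ω / √v)) P :=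
    ((hX.integrable (by norm_num)).div_const _).const_mul _
  have i2 : Integrable (fun ω => 2 * K * (X ω / √v) ^ 2) P := by
    simp_rw [div_pow]
    exact ((integrable_pow_of_memLp_four hX (by norm_num)).div_const _).const_mul _
  have i4 : Integrable (fun ω => (X ω / √v) ^ 4) P := by
    simp_rw [div_pow]
    exact (integrable_pow_of_memLp_four hX (by norm_num)).div_const _
  have iA : Integrable (A.indicator (fun _ => 4 * K ^ 2 + 9 * K ^ 4)) P :=
    (integrable_const _).indicator hA
  have hI := integral_mono ((i1.add i2).sub i4) ((integrable_const (K / 2)).add iA) pw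
  have hL : ∫ ω, 4 * K ^ 2 * (X ω / √v) + 2 * K * (X ω / √v) ^ 2 - (X ω / √v) ^ 4 ∂P ≥ K := by
    rw [integral_sub (i1.fun_add i2) i4, integral_add i1 i2]
    simp_rw [div_pow]
    rw [integral_const_mul, integral_const_mul, integral_div, integral_div, integral_div, h1, h2,
      hs2, div_self hv.ne']
    have : (∫ ω, X ω ^ 4 ∂P) / √v ^ 4 ≤ K := by
      rw [div_le_iff₀ (by positivity), show √v ^ 4 = (√v ^ 2) ^ 2 by ring, hs2]
      exact h4
    rw [zero_div, mul_zero]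
    linarith
  have hR : ∫ ω, K / 2 + A.indicator (fun _ => 4 * K ^ 2 + 9 * K ^ 4) ω ∂P =
      K / 2 + P.real A * (4 * K ^ 2 + 9 * K ^ 4) := by
    rw [integral_add (integrable_const _) iA, integral_indicator_const _ hA]
    simp
  rw [div_le_iff₀ (by positivity)]
  have hI' := hL.le.trans (hI.trans hR.le)
  linarith

end Moments

/-! ### Zero-one law and almost sure unboundedness -/

section ZeroOne

lemma measurableSet_forall_exists_lt {m : MeasurableSpace Ω} {Z : ℕ → Ω → ℝ}
    (hZ : ∀ n, Measurable (Z n)) :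
    MeasurableSet {ω | ∀ j : ℕ, ∃ n ≥ j, (j : ℝ) < Z n ω} := by
  simp only [ofPred_forall, ofPred_exists, ofPred_and]
  exact MeasurableSet.iInter fun j => MeasurableSet.iUnion fun n =>
    (MeasurableSet.const _).inter (measurableSet_lt measurable_const (hZ n))

lemma forall_exists_lt_of_abs_sub_le {z z' : ℕ → ℝ} {D : ℝ} (hD : ∀ n, |z n - z' n| ≤ D)
    (h : ∀ j : ℕ, ∃ n ≥ j, (j : ℝ) < z n) (j : ℕ) : ∃ n ≥ j, (j : ℝ) < z' n := by
  obtain ⟨n, hn, hz⟩ := h (j + ⌈D⌉₊)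
  refine ⟨n, by omega, ?_⟩
  have h1 := (abs_le.1 (hD n)).2
  have h2 := Nat.le_ceil D
  push_cast at hz
  linarith

variable [MeasurableSpace Ω] {P : Measure Ω} {b K : ℝ} {Y : ℕ → Ω → ℝ}

/-- Since the weights are at most `1` in absolute value, dropping the first `m` variables changes
every sum by at most `∑_{k<m} |Y_k|`, uniformly in `n`. Unboundedness above is therefore a tail
event. -/
lemma IsNoise.measure_eq_zero_or_one (h : IsNoise P b K Y) {a : ℕ → ℕ → ℝ}
    (ha : ∀ n k, |a n k| ≤ 1) (N : ℕ → ℕ) :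
    P {ω | ∀ j : ℕ, ∃ n ≥ j, (j : ℝ) < ∑ k ∈ Finset.range (N n), a n k * Y k ω} = 0 ∨
    P {ω | ∀ j : ℕ, ∃ n ≥ j, (j : ℝ) < ∑ k ∈ Finset.range (N n), a n k * Y k ω} = 1 := by
  refine measure_zero_or_one_of_measurableSet_limsup_atTop
    (s := fun k => MeasurableSpace.comap (Y k) inferInstance)
    (fun k => (h.measurable k).comap_le) h.indep ?_
  rw [limsup_eq_iInf_iSup_of_nat, MeasurableSpace.measurableSet_iInf]
  intro m
  have heq : {ω | ∀ j : ℕ, ∃ n ≥ j, (j : ℝ) < ∑ k ∈ Finset.range (N n), a n k * Y k ω} =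
      {ω | ∀ j : ℕ, ∃ n ≥ j,
        (j : ℝ) < ∑ k ∈ Finset.range (N n) with m ≤ k, a n k * Y k ω} := by
    ext ω
    have hD (n : ℕ) : |∑ k ∈ Finset.range (N n), a n k * Y k ω
        - ∑ k ∈ Finset.range (N n) with m ≤ k, a n k * Y k ω| ≤
        ∑ k ∈ Finset.range m, |Y k ω| := by
      rw [← Finset.sum_filter_add_sum_filter_not (Finset.range (N n)) (fun k => m ≤ k),
        add_sub_cancel_left]
      calc |∑ k ∈ Finset.range (N n) with ¬ m ≤ k, a n k * Y k ω|
          ≤ ∑ k ∈ Finset.range (N n) with ¬ m ≤ k, |a n k * Y k ω| :=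
            Finset.abs_sum_le_sum_abs _ _
        _ ≤ ∑ k ∈ Finset.range (N n) with ¬ m ≤ k, |Y k ω| := by
            refine Finset.sum_le_sum fun k _ => ?_
            rw [abs_mul]
            exact mul_le_of_le_one_left (abs_nonneg _) (ha n k)
        _ ≤ ∑ k ∈ Finset.range m, |Y k ω| := by
            refine Finset.sum_le_sum_of_subset_of_nonneg (fun k hk => ?_) fun k _ _ => abs_nonneg _
            simp only [Finset.mem_filter, Finset.mem_range] at hk ⊢
            omega
    exact ⟨fun hω => forall_exists_lt_of_abs_sub_le hD hω, fun hω =>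
      forall_exists_lt_of_abs_sub_le (fun n => by rw [abs_sub_comm]; exact hD n) hω⟩
  rw [heq]
  refine @measurableSet_forall_exists_lt Ω (_) _ fun n => ?_
  refine @Finset.measurable_fun_sum _ _ _ _ _ _ (_) _ _ fun k hk => ?_
  have hmk : m ≤ k := (Finset.mem_filter.1 hk).2
  refine @Measurable.const_mul _ _ _ _ _ (_) _ ?_ _
  exact (comap_measurable (Y k)).mono
    (le_iSup₂_of_le (f := fun i (_ : i ≥ m) => MeasurableSpace.comap (Y i) inferInstance)
      k hmk le_rfl) le_rfl

/-- Weighted sums of noise variables with bounded weights and unbounded variances are almost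
surely unbounded above along every such sequence. -/
lemma IsNoise.ae_forall_exists_lt [IsProbabilityMeasure P] (h : IsNoise P b K Y) (hb : 0 < b)
    {a : ℕ → ℕ → ℝ} (ha : ∀ n k, |a n k| ≤ 1) {N : ℕ → ℕ}
    (hN : Tendsto (fun n => ∑ k ∈ Finset.range (N n), a n k ^ 2) atTop atTop) :
    ∀ᵐ ω ∂P, ∀ j : ℕ, ∃ n ≥ j, (j : ℝ) < ∑ k ∈ Finset.range (N n), a n k * Y k ω := by
  set Z : ℕ → Ω → ℝ := fun n ω => ∑ k ∈ Finset.range (N n), a n k * Y k ω with hZ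
  have hZm (n : ℕ) : Measurable (Z n) :=
    Finset.measurable_fun_sum _ fun k _ => (h.measurable k).const_mul _
  set F : ℕ → Set Ω := fun j => {ω | ∃ n ≥ j, (j : ℝ) < Z n ω} with hF
  have hFm (j : ℕ) : MeasurableSet (F j) := by
    simp only [hF, ofPred_exists, ofPred_and]
    exact MeasurableSet.iUnion fun n =>
      (MeasurableSet.const _).inter (measurableSet_lt measurable_const (hZm n))
  have hanti : Antitone F := by
    rintro i j hij ω ⟨n, hn, hlt⟩
    exact ⟨n, hij.trans hn, lt_of_le_of_lt (by exact_mod_cast hij) hlt⟩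
  have hG : {ω | ∀ j : ℕ, ∃ n ≥ j, (j : ℝ) < Z n ω} = ⋂ j, F j := by
    ext ω; simp [hF]
  set K' : ℝ := max 1 ((3 * b ^ 2 + K) / b ^ 2)
  obtain ⟨ε, hε, δ, hδ, hPZ⟩ := exists_le_measureReal_lt (P := P) (K := K') (le_max_left _ _)
  have hlow (j : ℕ) : δ ≤ P.real (F j) := by
    have ht : Tendsto (fun n => ε * √(b * ∑ k ∈ Finset.range (N n), a n k ^ 2)) atTop atTop :=
      (Real.tendsto_sqrt_atTop.comp (hN.const_mul_atTop hb)).const_mul_atTop hε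
    obtain ⟨n, hn1, hn2, hn3⟩ := ((ht.eventually_gt_atTop (j : ℝ)).and
      ((hN.eventually_gt_atTop 0).and (eventually_ge_atTop j))).exists
    refine (hPZ (Z n) (b * ∑ k ∈ Finset.range (N n), a n k ^ 2) (by positivity)
      (h.memLp_sum (a n) (N n)) (hZm n) (h.integral_sum _ _) (h.integral_sum_sq _ _) ?_).trans ?_
    · refine (h.integral_sum_pow_four_le _ _).trans ?_
      rw [mul_pow, ← mul_assoc]
      gcongr
      rw [← div_le_iff₀ (by positivity)]
      exact le_max_right _ _
    · exact measureReal_mono fun ω hω => ⟨n, hn3, hn1.trans hω⟩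
  -- The `F j` decrease and each has probability at least `δ`, hence so has their intersection.
  have hpos : P (⋂ j, F j) ≠ 0 := by
    have ht := tendsto_measure_iInter_atTop (μ := P) (fun j => (hFm j).nullMeasurableSet) hanti
      ⟨0, measure_ne_top _ _⟩
    intro h0
    rw [h0] at ht
    have h1 : ENNReal.ofReal δ ≤ 0 := ge_of_tendsto' ht fun j => by
      exact (ENNReal.ofReal_le_iff_le_toReal (measure_ne_top _ _)).2 (hlow j)
    simp at h1
    linarith
  rcases h.measure_eq_zero_or_one ha N with h0 | h1
  · exact absurd (hG ▸ h0) hpos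
  · exact mem_ae_iff.2 ((prob_compl_eq_zero_iff (measurableSet_forall_exists_lt hZm)).2 h1)

end ZeroOne

/-! ### Random Dirichlet series to the right of `1/2` -/

section Convergence

variable [MeasurableSpace Ω] {P : Measure Ω} {b K : ℝ} {Y : ℕ → Ω → ℝ}

/-- The partial sums form a martingale, bounded in `L¹` because `|x| ≤ 1 + x²` and the variances are
bounded. -/
lemma IsNoise.ae_exists_tendsto [IsProbabilityMeasure P] (h : IsNoise P b K Y) {a : ℕ → ℝ}
    (ha : Summable fun k => a k ^ 2) :
    ∀ᵐ ω ∂P, ∃ l, Tendsto (fun n => ∑ k ∈ Finset.range n, a k * Y k ω) atTop (𝓝 l) := by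
  set X : ℕ → Ω → ℝ := fun k ω => a k * Y k ω with hX
  have hXs (k : ℕ) : StronglyMeasurable (X k) := ((h.measurable k).const_mul _).stronglyMeasurable
  have hXi (k : ℕ) : Integrable (X k) P := ((h.memLp k).integrable (by norm_num)).const_mul _
  have hXind : iIndepFun X P := h.indep.comp (fun k x => a k * x) fun k => measurable_const_mul _
  set ℱ := Filtration.natural X hXs
  set S : ℕ → Ω → ℝ := fun n ω => ∑ k ∈ Finset.range (n + 1), X k ω with hS
  have hSi (n : ℕ) : Integrable (S n) P := integrable_finsetSum _ fun k _ => hXi k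
  have hmart : Martingale S ℱ P := by
    refine martingale_of_condExp_sub_eq_zero_nat (fun n => ?_) hSi fun n => ?_
    · refine Finset.stronglyMeasurable_fun_sum _ fun k hk => ?_
      exact ((Filtration.stronglyAdapted_natural hXs) k).mono
        (ℱ.mono (Nat.lt_succ_iff.1 (Finset.mem_range.1 hk)))
    · have e : S (n + 1) - S n = X (n + 1) := by
        ext ω
        simp [hS, Finset.sum_range_succ _ (n + 1)]
      rw [e]
      refine (hXind.condExp_natural_ae_eq_of_lt hXs (Nat.lt_succ_self n)).trans ?_
      refine ae_of_all _ fun ω => ?_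
      simp [hX, integral_const_mul, h.mean]
  have hbdd (n : ℕ) : eLpNorm (S n) 1 P ≤ (1 + b * ∑' k, a k ^ 2).toNNReal := by
    have hb : 0 ≤ b := h.sq 0 ▸ integral_nonneg fun ω => sq_nonneg _
    rw [eLpNorm_one_eq_lintegral_enorm, ← ofReal_integral_norm_eq_lintegral_enorm (hSi n)]
    refine ENNReal.ofReal_le_ofReal ?_
    have i2 := integrable_pow_of_memLp_four (h.memLp_sum a (n + 1)) (i := 2) (by norm_num)
    calc ∫ ω, ‖S n ω‖ ∂P ≤ ∫ ω, 1 + S n ω ^ 2 ∂P := by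
          refine integral_mono (hSi n).norm ((integrable_const _).fun_add i2) fun ω => ?_
          change |S n ω| ≤ 1 + S n ω ^ 2
          nlinarith [sq_abs (S n ω), sq_nonneg (|S n ω| - 1)]
      _ = 1 + b * ∑ k ∈ Finset.range (n + 1), a k ^ 2 := by
          rw [integral_add (integrable_const _) i2, h.integral_sum_sq]
          simp
      _ ≤ 1 + b * ∑' k, a k ^ 2 := by
          gcongr
          exact ha.sum_le_tsum _ fun k _ => sq_nonneg _
  filter_upwards [hmart.submartingale.ae_tendsto_limitProcess hbdd] with ω hω
  exact ⟨_, (tendsto_add_atTop_iff_nat 1).1 hω⟩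

/-- Dirichlet's test: the extra factor `(k+1)^(-(t-s))` decreases to zero. Being deterministic, this
lets countably many exponents control all of them off one null set. -/
lemma tendsto_dirichlet_of_lt {y : ℕ → ℝ} {s t l : ℝ} (hst : s < t)
    (h : Tendsto (fun n => ∑ k ∈ Finset.range n, ((k : ℝ) + 1) ^ (-s) * y k) atTop (𝓝 l)) :
    ∃ l', Tendsto (fun n => ∑ k ∈ Finset.range n, ((k : ℝ) + 1) ^ (-t) * y k) atTop (𝓝 l') := by
  obtain ⟨B, hB⟩ := (Metric.isBounded_range_of_tendsto _ h).exists_norm_le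
  have hanti : Antitone fun k : ℕ => ((k : ℝ) + 1) ^ (-(t - s)) := by
    intro i j hij
    exact Real.rpow_le_rpow_of_nonpos (by positivity) (by gcongr) (by linarith)
  have h0 : Tendsto (fun k : ℕ => ((k : ℝ) + 1) ^ (-(t - s))) atTop (𝓝 0) :=
    (tendsto_rpow_neg_atTop (by linarith)).comp
      (tendsto_natCast_atTop_atTop.atTop_add tendsto_const_nhds)
  have := hanti.cauchySeq_series_mul_of_tendsto_zero_of_bounded h0
    (fun n => hB _ (mem_range_self n))
  refine cauchySeq_tendsto_of_complete ?_
  convert this using 4 with n k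
  rw [smul_eq_mul, ← mul_assoc, ← Real.rpow_add (by positivity)]
  ring_nf

lemma summable_rpow_neg_sq {s : ℝ} (hs : 1 / 2 < s) :
    Summable fun k : ℕ => (((k : ℝ) + 1) ^ (-s)) ^ 2 := by
  have := (summable_nat_add_iff 1).2 (Real.summable_nat_rpow.2 (by linarith : -(2 * s) < -1))
  refine this.congr fun k => ?_
  rw [← Real.rpow_mul_natCast (by positivity)]
  push_cast
  ring_nf

/-- Random Dirichlet series converge to the right of `1 / 2`, simultaneously. -/
lemma IsNoise.ae_forall_exists_tendsto [IsProbabilityMeasure P] (h : IsNoise P b K Y) :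
    ∀ᵐ ω ∂P, ∀ s > (1 / 2 : ℝ), ∃ l,
      Tendsto (fun n => ∑ k ∈ Finset.range n, ((k : ℝ) + 1) ^ (-s) * Y k ω) atTop (𝓝 l) := by
  have h1 : ∀ᵐ ω ∂P, ∀ m : ℕ, ∃ l, Tendsto (fun n => ∑ k ∈ Finset.range n,
      ((k : ℝ) + 1) ^ (-(1 / 2 + 1 / ((m : ℝ) + 1))) * Y k ω) atTop (𝓝 l) :=
    ae_all_iff.2 fun m => h.ae_exists_tendsto
      (summable_rpow_neg_sq (lt_add_of_pos_right _ (by positivity)))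
  filter_upwards [h1] with ω hω s hs
  obtain ⟨m, hm⟩ := exists_nat_one_div_lt (sub_pos.2 hs)
  obtain ⟨l, hl⟩ := hω m
  exact tendsto_dirichlet_of_lt (by linarith) hl

/-- At exponent `1/2` the squares form the harmonic series; a long finite section of it stays large
for nearby `s` by continuity. -/
lemma exists_lt_sum_rpow_neg_sq (C : ℝ) {η : ℝ} (hη : 0 < η) :
    ∃ s ∈ Ioo (1 / 2) (1 / 2 + η), ∃ M : ℕ,
      C < ∑ k ∈ Finset.range M, (((k : ℝ) + 1) ^ (-s)) ^ 2 := by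
  have hdiv : Tendsto (fun M => ∑ k ∈ Finset.range M, 1 / ((k : ℝ) + 1)) atTop atTop :=
    Real.tendsto_sum_range_one_div_nat_succ_atTop
  obtain ⟨M, hM⟩ := (hdiv.eventually_gt_atTop C).exists
  have hc : Tendsto (fun s : ℝ => ∑ k ∈ Finset.range M, (((k : ℝ) + 1) ^ (-s)) ^ 2) (𝓝 (1 / 2))
      (𝓝 (∑ k ∈ Finset.range M, (((k : ℝ) + 1) ^ (-(1 / 2) : ℝ)) ^ 2)) := by
    refine tendsto_finsetSum _ fun k _ => ?_
    have : Continuous fun s : ℝ => (((k : ℝ) + 1) ^ (-s)) ^ 2 :=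
      ((Real.continuous_const_rpow (by positivity)).comp continuous_neg).pow 2
    exact this.tendsto _
  have e : ∑ k ∈ Finset.range M, (((k : ℝ) + 1) ^ (-(1 / 2) : ℝ)) ^ 2 =
      ∑ k ∈ Finset.range M, 1 / ((k : ℝ) + 1) := by
    refine Finset.sum_congr rfl fun k _ => ?_
    rw [← Real.rpow_mul_natCast (by positivity)]
    norm_num [Real.rpow_neg_one]
  rw [← e] at hM
  have h1 := (hc.mono_left (nhdsWithin_le_nhds (s := Ioi (1 / 2)))).eventually_const_lt hM
  obtain ⟨s, hs1, hs2⟩ := (h1.and (Ioo_mem_nhdsGT (by linarith : (1 / 2 : ℝ) < 1 / 2 + η))).exists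
  exact ⟨s, hs2, M, hs1⟩

/-- Random Dirichlet series are almost surely unbounded above along suitable (deterministic)
sequences tending to `1 / 2`. -/
lemma IsNoise.exists_seq_ae_unbounded [IsProbabilityMeasure P] (h : IsNoise P b K Y)
    (hb : 0 < b) :
    ∃ (s : ℕ → ℝ) (S : ℕ → Ω → ℝ), (∀ n : ℕ, s n ∈ Ioo (1 / 2 : ℝ) (1 / 2 + 1 / ((n : ℝ) + 4))) ∧
      (∀ n, AEMeasurable (S n) P) ∧
      (∀ᵐ ω ∂P, ∀ n, Tendsto (fun N => ∑ k ∈ Finset.range N, ((k : ℝ) + 1) ^ (-s n) * Y k ω)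
        atTop (𝓝 (S n ω))) ∧
      ∀ᵐ ω ∂P, ∀ C : ℝ, ∃ᶠ n in atTop, C < S n ω := by
  choose s hs M hM using fun n : ℕ =>
    exists_lt_sum_rpow_neg_sq n (η := 1 / ((n : ℝ) + 4)) (by positivity)
  set Z : ℕ → ℕ → Ω → ℝ := fun n N ω => ∑ k ∈ Finset.range N, ((k : ℝ) + 1) ^ (-s n) * Y k ω
  have hZm (n N : ℕ) : Measurable (Z n N) :=
    Finset.measurable_fun_sum _ fun k _ => (h.measurable k).const_mul _
  set S : ℕ → Ω → ℝ := fun n ω => limUnder atTop fun N => Z n N ω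
  have hlim : ∀ᵐ ω ∂P, ∀ n, Tendsto (fun N => Z n N ω) atTop (𝓝 (S n ω)) := by
    filter_upwards [h.ae_forall_exists_tendsto] with ω hω n
    exact tendsto_nhds_limUnder (hω (s n) (hs n).1)
  have hSm (n : ℕ) : AEMeasurable (S n) P :=
    aemeasurable_of_tendsto_metrizable_ae atTop (fun N => (hZm n N).aemeasurable)
      (hlim.mono fun ω hω => hω n)
  refine ⟨s, S, hs, hSm, hlim, ?_⟩
  -- Truncation past `M n` keeps the sum of squares above `n`, and errors of size at least `1` have
  -- summable probabilities, so Borel–Cantelli transfers unboundedness from the finite sums to `S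
  -- n`.
  have hN (n : ℕ) : ∃ N ≥ M n, P {ω | 1 ≤ dist (Z n N ω) (S n ω)} ≤ (1 / 2) ^ n := by
    have := tendstoInMeasure_of_tendsto_ae (fun N => (hZm n N).aestronglyMeasurable)
      (hlim.mono fun ω hω => hω n)
    rw [tendstoInMeasure_iff_dist] at this
    have h2 := (this 1 one_pos).eventually_le_const
      (u := (1 / 2) ^ n) (by simp [pos_iff_ne_zero])
    exact ((eventually_ge_atTop (M n)).and h2).exists
  choose N hNM hNP using hN
  have hBC : ∀ᵐ ω ∂P, ∀ᶠ n in atTop, ω ∉ {ω | 1 ≤ dist (Z n (N n) ω) (S n ω)} := by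
    refine ae_eventually_notMem (ne_top_of_le_ne_top ?_ (ENNReal.tsum_le_tsum hNP))
    simp [ENNReal.tsum_geometric]
  have hU := h.ae_forall_exists_lt hb (a := fun n k => ((k : ℝ) + 1) ^ (-s n)) (N := N)
    (fun n k => by
      rw [abs_of_nonneg (by positivity)]
      exact Real.rpow_le_one_of_one_le_of_nonpos (by linarith [k.cast_nonneg (α := ℝ)])
        (by linarith [(hs n).1])) (by
      refine tendsto_atTop_mono (fun n => ?_) (tendsto_natCast_atTop_atTop (R := ℝ))
      refine (hM n).le.trans ?_
      exact Finset.sum_le_sum_of_subset_of_nonneg (Finset.range_mono (hNM n))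
        fun k _ _ => sq_nonneg _)
  filter_upwards [hBC, hU] with ω h1 h2 C
  obtain ⟨n₀, hn₀⟩ := eventually_atTop.1 h1
  rw [frequently_atTop]
  intro n₁
  obtain ⟨n, hn, hlt⟩ := h2 (max (max n₀ n₁) ⌈C + 1⌉₊)
  refine ⟨n, (le_max_right n₀ n₁).trans ((le_max_left _ _).trans hn), ?_⟩
  have h3 := hn₀ n ((le_max_left n₀ n₁).trans ((le_max_left _ _).trans hn))
  rw [not_le, Real.dist_eq] at h3
  have h4 : C + 1 < Z n (N n) ω := by
    refine lt_of_le_of_lt ((Nat.le_ceil (C + 1)).trans ?_) hlt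
    exact_mod_cast le_max_right _ _
  linarith [(abs_lt.1 h3).2]

end Convergence

/-! ### Moments of the Poisson distribution -/

section Poisson

open scoped Nat in
lemma integrable_pow_four_poissonMeasure (r : ℝ≥0) :
    Integrable (fun n : ℕ => (n : ℝ) ^ 4) (poissonMeasure r) := by
  rw [integrable_poissonMeasure_iff]
  have hs := ((Real.summable_pow_div_factorial (r * Real.exp 1)).mul_left (24 * Real.exp (-r)))
  refine hs.of_nonneg_of_le (fun n => by positivity) fun n => ?_
  have h1 : (n : ℝ) ^ 4 ≤ 24 * Real.exp 1 ^ n := by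
    have := Real.pow_div_factorial_le_exp (n : ℝ) n.cast_nonneg 4
    rw [div_le_iff₀ (by positivity)] at this
    norm_num [Nat.factorial] at this
    rw [← Real.exp_nat_mul, mul_one]
    linarith
  rw [Real.norm_of_nonneg (by positivity), mul_pow]
  calc Real.exp (-r) * r ^ n / n ! * (n : ℝ) ^ 4
      ≤ Real.exp (-r) * r ^ n / n ! * (24 * Real.exp 1 ^ n) := by gcongr
    _ = 24 * Real.exp (-r) * (r ^ n * Real.exp 1 ^ n / n !) := by ring

lemma memLp_four_poissonMeasure (r : ℝ≥0) :
    MemLp (fun n : ℕ => (n : ℝ)) 4 (poissonMeasure r) := by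
  have h : AEStronglyMeasurable (fun n : ℕ => (n : ℝ)) (poissonMeasure r) :=
    (measurable_of_countable _).aestronglyMeasurable
  refine (integrable_norm_rpow_iff h (by norm_num) (by norm_num)).1 ?_
  refine (integrable_pow_four_poissonMeasure r).congr (ae_of_all _ fun n => ?_)
  simp only [Real.norm_natCast, ENNReal.toReal_ofNat]
  exact_mod_cast rfl

open scoped Nat in
lemma integral_natCast_poissonMeasure (r : ℝ≥0) :
    ∫ n : ℕ, (n : ℝ) ∂(poissonMeasure r) = r := by
  have h1 := hasSum_integral_poissonMeasure
    ((memLp_four_poissonMeasure r).integrable (by norm_num))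
  have h2 : HasSum (fun n : ℕ => (Real.exp (-r) * r ^ (n + 1) / (n + 1)!) • ((n + 1 : ℕ) : ℝ))
      r := by
    have := (hasSum_one_poissonMeasure r).mul_left (r : ℝ)
    rw [mul_one] at this
    have e : (fun n : ℕ => (Real.exp (-r) * r ^ (n + 1) / (n + 1)!) • ((n + 1 : ℕ) : ℝ)) =
        fun n => r * (Real.exp (-r) * r ^ n / n !) := by
      ext n
      rw [Nat.factorial_succ, smul_eq_mul, pow_succ]
      push_cast
      field_simp
    rwa [e]
  have h3 := (hasSum_nat_add_iff
    (f := fun n : ℕ => (Real.exp (-r) * r ^ n / n !) • (n : ℝ)) 1).1 h2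
  simp only [Finset.range_one, Finset.sum_singleton, Nat.cast_zero, smul_zero, add_zero] at h3
  exact h1.unique h3

end Poisson

/-! ### The unit increments of `R` as noise -/

section Increments

variable [MeasurableSpace Ω] {P : Measure Ω} {T : ℕ → Ω → ℝ}

/-- The increment of `R(V) = N(V) - V` over `(k + 1, k + 2]`. -/
noncomputable def unitIncrement (T : ℕ → Ω → ℝ) (k : ℕ) (ω : Ω) : ℝ :=
  2 * ((count T (k + 2 : ℕ) ω - count T (k + 1 : ℕ) ω : ℕ) : ℝ) - 1

/-- `HasLaw` gives the counts only almost everywhere measurability, so the noise is built from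
measurable modifications. -/
lemma exists_isNoise_ae_eq_unitIncrement (hT : IsPoissonPoints P (1 / 2) T) :
    ∃ (b K : ℝ) (Y : ℕ → Ω → ℝ), 0 < b ∧ IsNoise P b K Y ∧
      ∀ᵐ ω ∂P, ∀ k, Y k ω = unitIncrement T k ω := by
  set n : ℕ → Ω → ℕ := fun k ω => count T (k + 2 : ℕ) ω - count T (k + 1 : ℕ) ω with hn
  have hlaw (k : ℕ) : HasLaw (n k) (poissonMeasure (1 / 2)) P := by
    have := hT.hasLaw_increment (k + 1 : ℕ) (k + 2 : ℕ) (by exact_mod_cast Nat.le_succ _)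
    have e : (((k + 2 : ℕ) : ℝ≥0) - ((k + 1 : ℕ) : ℝ≥0)) = 1 := by
      rw [show k + 2 = (k + 1) + 1 from rfl, Nat.cast_add (k + 1) 1, add_tsub_cancel_left,
        Nat.cast_one]
    rw [e, mul_one] at this
    exact this
  have hind : iIndepFun n P := by
    have := hT.hasIndepIncrements.nat (t := fun k : ℕ => ((k + 1 : ℕ) : ℝ≥0))
      (fun i j hij => by simpa using hij)
    exact this
  set g : ℕ → ℝ := fun m => 2 * (m : ℝ) - 1 with hg
  have hgm : Measurable g := measurable_of_countable _
  set ν := poissonMeasure (1 / 2)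
  have hgL : MemLp g 4 ν := ((memLp_four_poissonMeasure _).const_mul 2).sub (memLp_const 1)
  set m : ℕ → Ω → ℕ := fun k => (hlaw k).aemeasurable.mk (n k)
  have hm (k : ℕ) : n k =ᵐ[P] m k := (hlaw k).aemeasurable.ae_eq_mk
  have hmm (k : ℕ) : Measurable (m k) := (hlaw k).aemeasurable.measurable_mk
  have hlm (k : ℕ) : P.map (m k) = ν := by
    rw [← Measure.map_congr (hm k), (hlaw k).map_eq]
  have hint (φ : ℝ → ℝ) (k : ℕ) : ∫ ω, φ (g (m k ω)) ∂P = ∫ j, φ (g j) ∂ν := by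
    rw [← hlm k, integral_map (hmm k).aemeasurable
      (measurable_of_countable _).aestronglyMeasurable]
  refine ⟨∫ j, g j ^ 2 ∂ν, ∫ j, g j ^ 4 ∂ν, fun k ω => g (m k ω), ?_, ⟨?_, ?_, ?_, ?_, ?_, ?_⟩, ?_⟩
  -- The variance is at least `1`, because `2j - 1` is an odd integer.
  · have h1 : ∫ _, (1 : ℝ) ∂ν ≤ ∫ j, g j ^ 2 ∂ν := by
      refine integral_mono (integrable_const _)
        (integrable_pow_of_memLp_four hgL (by norm_num)) fun j => ?_
      rcases Nat.eq_zero_or_pos j with rfl | hj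
      · simp [hg]
      · have : (1 : ℝ) ≤ j := by exact_mod_cast hj
        simp only [hg]
        nlinarith
    simp only [integral_const, probReal_univ, smul_eq_mul, mul_one] at h1
    linarith
  · exact fun k => hgm.comp (hmm k)
  · exact (hind.congr hm).comp (fun _ => g) fun _ => hgm
  · exact fun k => (hlm k ▸ hgL).comp_of_map (hmm k).aemeasurable
  · intro k
    refine (hint id k).trans ?_
    simp only [id, hg]
    rw [integral_sub (((memLp_four_poissonMeasure _).integrable (by norm_num)).const_mul 2)
      (integrable_const _), integral_const_mul, integral_natCast_poissonMeasure]
    simp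
  · exact hint fun x => x ^ 2
  · exact fun k => (hint (fun x => x ^ 4) k).le
  · filter_upwards [ae_all_iff.2 hm] with ω hω k
    simp only [hg, ← hω k]
    rfl

end Increments

/-! ### Pathwise comparison of truncated integrals with Dirichlet series -/

section Deterministic

variable {T : ℕ → Ω → ℝ} {ω : Ω}

lemma le_iff_lt_count (hmono : StrictMono fun j => T j ω)
    (htop : Tendsto (fun j => T j ω) atTop atTop) (V : ℝ≥0) (j : ℕ) :
    T j ω ≤ V ↔ j < count T V ω := by
  have hex : ∃ m, (V : ℝ) < T m ω := (htop.eventually_gt_atTop (V : ℝ)).exists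
  classical
  -- Divergence of the points makes this a finite initial segment; on an infinite set `ncard` would
  -- return `0`.
  have hset : {j : ℕ | T j ω ≤ V} = ↑(Finset.range (Nat.find hex)) := by
    ext i
    rw [Finset.coe_range, mem_Iio, Nat.lt_find_iff]
    constructor
    · intro hi m hm
      exact not_lt.2 ((hmono.monotone hm).trans hi)
    · intro hi
      exact not_lt.1 (hi i le_rfl)
  have hc : count T V ω = Nat.find hex := by
    rw [count, hset, ncard_coe_finset, Finset.card_range]
  rw [hc, ← mem_Iio, ← Finset.coe_range, ← hset]
  rfl

lemma count_mono (hmono : StrictMono fun j => T j ω)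
    (htop : Tendsto (fun j => T j ω) atTop atTop) {U V : ℝ≥0} (h : U ≤ V) :
    count T U ω ≤ count T V ω := by
  by_contra! hlt
  have := (le_iff_lt_count hmono htop U _).2 hlt
  exact lt_irrefl _ ((le_iff_lt_count hmono htop V _).1 (this.trans (by exact_mod_cast h)))

lemma setIntegral_dN (hpos : ∀ j, 0 < T j ω) (hmono : StrictMono fun j => T j ω)
    (htop : Tendsto (fun j => T j ω) atTop atTop) (V : ℝ≥0) (p : ℝ) :
    ∫ x in Ioc (0 : ℝ) V, x ^ p ∂(dN T ω) =
      2 * ∑ j ∈ Finset.range (count T V ω), T j ω ^ p := by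
  have hr : (Measure.sum fun j => Measure.dirac (T j ω)).restrict (Ioc (0 : ℝ) V) =
      ∑ j ∈ Finset.range (count T V ω), Measure.dirac (T j ω) := by
    rw [Measure.restrict_sum _ measurableSet_Ioc]
    ext s hs
    rw [Measure.sum_apply _ hs, Measure.finsetSum_apply,
      tsum_eq_sum (s := Finset.range (count T V ω))]
    · refine Finset.sum_congr rfl fun j hj => ?_
      rw [restrict_dirac' measurableSet_Ioc, if_pos]
      exact ⟨hpos j, (le_iff_lt_count hmono htop V j).2 (Finset.mem_range.1 hj)⟩
    · intro j hj
      rw [restrict_dirac' measurableSet_Ioc, if_neg]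
      · rfl
      · exact fun h => hj (Finset.mem_range.2 ((le_iff_lt_count hmono htop V j).1 h.2))
  rw [dN, Measure.restrict_smul, integral_smul_nnreal_measure, hr,
    integral_finsetSum_measure fun j _ => integrable_dirac (by finiteness)]
  simp [NNReal.smul_def]

lemma truncIntegral_eq (hpos : ∀ j, 0 < T j ω) (hmono : StrictMono fun j => T j ω)
    (htop : Tendsto (fun j => T j ω) atTop atTop) (V : ℝ≥0) (c : ℝ) :
    truncIntegral T c V ω = 2 * ∑ j ∈ Finset.range (count T V ω), T j ω ^ (-(2 * c)) -
      ∫ x in (0 : ℝ)..V, x ^ (-(2 * c)) := by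
  rw [truncIntegral, neg_mul, setIntegral_dN hpos hmono htop,
    intervalIntegral.integral_of_le V.coe_nonneg]

lemma neg_le_truncIntegral_one (hpos : ∀ j, 0 < T j ω) (hmono : StrictMono fun j => T j ω)
    (htop : Tendsto (fun j => T j ω) atTop atTop) {c : ℝ} (hc : c < 1 / 2) :
    -(1 / (1 - 2 * c)) ≤ truncIntegral T c 1 ω := by
  have h := truncIntegral_eq hpos hmono htop 1 c
  rw [NNReal.coe_one] at h
  rw [h, integral_rpow (Or.inl (by linarith)), Real.one_rpow, Real.zero_rpow (by linarith)]
  have : 0 ≤ ∑ j ∈ Finset.range (count T 1 ω), T j ω ^ (-(2 * c)) :=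
    Finset.sum_nonneg fun j _ => (Real.rpow_pos_of_pos (hpos j) _).le
  rw [show -(2 * c) + 1 = 1 - 2 * c by ring, sub_zero]
  linarith

lemma truncIntegral_sub_eq (hpos : ∀ j, 0 < T j ω) (hmono : StrictMono fun j => T j ω)
    (htop : Tendsto (fun j => T j ω) atTop atTop) {U V : ℝ≥0} (hUV : U ≤ V) {c : ℝ}
    (hc : c < 1 / 2) :
    truncIntegral T c V ω - truncIntegral T c U ω =
      2 * ∑ j ∈ Finset.Ico (count T U ω) (count T V ω), T j ω ^ (-(2 * c)) -
        ∫ x in (U : ℝ)..V, x ^ (-(2 * c)) := by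
  have hi (u v : ℝ) : IntervalIntegrable (fun x : ℝ => x ^ (-(2 * c))) volume u v :=
    intervalIntegral.intervalIntegrable_rpow' (by linarith)
  rw [truncIntegral_eq hpos hmono htop, truncIntegral_eq hpos hmono htop,
    Finset.sum_Ico_eq_sub _ (count_mono hmono htop hUV),
    ← intervalIntegral.integral_interval_sub_left (hi 0 V) (hi 0 U)]
  ring

/-- On a short interval the kernel of the truncated integral is almost constant. -/
lemma truncIntegral_sub_bounds (hpos : ∀ j, 0 < T j ω) (hmono : StrictMono fun j => T j ω)
    (htop : Tendsto (fun j => T j ω) atTop atTop) {U V : ℝ≥0} (hU : 0 < U) (hUV : U ≤ V) {c : ℝ}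
    (hc0 : 0 ≤ c) (hc : c < 1 / 2) :
    2 * (count T V ω - count T U ω : ℕ) * (V : ℝ) ^ (-(2 * c)) - (V - U) * (U : ℝ) ^ (-(2 * c))
      ≤ truncIntegral T c V ω - truncIntegral T c U ω ∧
    truncIntegral T c V ω - truncIntegral T c U ω ≤
      2 * (count T V ω - count T U ω : ℕ) * (U : ℝ) ^ (-(2 * c))
        - (V - U) * (V : ℝ) ^ (-(2 * c)) := by
  have hU' : (0 : ℝ) < U := by exact_mod_cast hU
  have hUV' : (U : ℝ) ≤ V := by exact_mod_cast hUV
  have hanti {x y : ℝ} (hx : 0 < x) (hxy : x ≤ y) : y ^ (-(2 * c)) ≤ x ^ (-(2 * c)) :=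
    Real.rpow_le_rpow_of_nonpos hx hxy (by linarith)
  have hi (u v : ℝ) : IntervalIntegrable (fun x : ℝ => x ^ (-(2 * c))) volume u v :=
    intervalIntegral.intervalIntegrable_rpow' (by linarith)
  have hconst (a : ℝ) : ∫ _ in (U : ℝ)..V, a = (V - U) * a := by simp
  rw [truncIntegral_sub_eq hpos hmono htop hUV hc]
  have hI1 : ∫ x in (U : ℝ)..V, x ^ (-(2 * c)) ≤ (V - U) * (U : ℝ) ^ (-(2 * c)) := by
    rw [← hconst]
    exact intervalIntegral.integral_mono_on hUV' (hi _ _) intervalIntegrable_const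
      fun x hx => hanti hU' hx.1
  have hI2 : (V - U) * (V : ℝ) ^ (-(2 * c)) ≤ ∫ x in (U : ℝ)..V, x ^ (-(2 * c)) := by
    rw [← hconst]
    exact intervalIntegral.integral_mono_on hUV' intervalIntegrable_const (hi _ _)
      fun x hx => hanti (hU'.trans_le hx.1) hx.2
  have hTle {j : ℕ} (hj : j ∈ Finset.Ico (count T U ω) (count T V ω)) : U ≤ T j ω ∧ T j ω ≤ V := by
    rw [Finset.mem_Ico] at hj
    refine ⟨?_, (le_iff_lt_count hmono htop V j).2 hj.2⟩
    by_contra! h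
    exact absurd ((le_iff_lt_count hmono htop U j).1 h.le) (not_lt.2 hj.1)
  have hS1 : ∑ j ∈ Finset.Ico (count T U ω) (count T V ω), T j ω ^ (-(2 * c)) ≤
      (count T V ω - count T U ω : ℕ) * (U : ℝ) ^ (-(2 * c)) := by
    have := Finset.sum_le_card_nsmul (Finset.Ico (count T U ω) (count T V ω)) _ _
      fun j hj => hanti hU' (hTle hj).1
    rwa [Nat.card_Ico, nsmul_eq_mul] at this
  have hS2 : (count T V ω - count T U ω : ℕ) * (V : ℝ) ^ (-(2 * c)) ≤
      ∑ j ∈ Finset.Ico (count T U ω) (count T V ω), T j ω ^ (-(2 * c)) := by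
    have := Finset.card_nsmul_le_sum (Finset.Ico (count T U ω) (count T V ω)) _ _
      fun j hj => hanti (hpos j) (hTle hj).2
    rwa [Nat.card_Ico, nsmul_eq_mul] at this
  constructor <;> linarith

/-- Since `x ≤ 1`, the ratio `(N/(N+1))^x` is at least `N/(N+1)`, which gains a factor `1/(N+1)`;
then `x ≥ 1/2` gives a bound free of `x`. It is used with `x = 2c`. -/
lemma rpow_neg_sub_rpow_neg_le {N x : ℝ} (hN : 1 ≤ N) (hx : 1 / 2 ≤ x) (hx1 : x ≤ 1) :
    N ^ (-x) - (N + 1) ^ (-x) ≤ N ^ (-(3 / 2) : ℝ) := by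
  have hN0 : 0 < N := by linarith
  have h1 : N / (N + 1) ≤ (N / (N + 1)) ^ x :=
    Real.self_le_rpow_of_le_one (by positivity) ((div_le_one (by linarith)).2 (by linarith)) hx1
  have h2 : (N + 1) ^ (-x) = N ^ (-x) * (N / (N + 1)) ^ x := by
    rw [Real.div_rpow hN0.le (by linarith), Real.rpow_neg hN0.le, Real.rpow_neg (by linarith)]
    have := (Real.rpow_pos_of_pos hN0 x).ne'
    field_simp
  calc N ^ (-x) - (N + 1) ^ (-x) = N ^ (-x) * (1 - (N / (N + 1)) ^ x) := by rw [h2]; ring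
    _ ≤ N ^ (-x) * (1 - N / (N + 1)) := by gcongr
    _ = N ^ (-x) * (1 / (N + 1)) := by congr 1; field_simp; ring
    _ ≤ N ^ (-(1 / 2) : ℝ) * (1 / N) := by
        gcongr
        linarith
    _ = N ^ (-(3 / 2) : ℝ) := by
        rw [one_div N, ← Real.rpow_neg_one, ← Real.rpow_add hN0]
        norm_num

lemma unitIncrement_add_two_pos (k : ℕ) : 0 < unitIncrement T k ω + 2 := by
  rw [unitIncrement]
  have := Nat.cast_nonneg (α := ℝ) (count T (k + 2 : ℕ) ω - count T (k + 1 : ℕ) ω)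
  linarith

/-- `unitIncrement T k ω + 2` is twice the number of points plus the length of the interval, i.e.
the total variation of `R` there. This bound passes from integer to real endpoints. -/
lemma abs_truncIntegral_sub_le (hpos : ∀ j, 0 < T j ω) (hmono : StrictMono fun j => T j ω)
    (htop : Tendsto (fun j => T j ω) atTop atTop) {c : ℝ} (hc0 : 0 ≤ c) (hc : c < 1 / 2)
    (k : ℕ) {A : ℝ} (h1 : (k : ℝ) + 1 ≤ A) (h2 : A ≤ k + 2) :
    |truncIntegral T c A ω - truncIntegral T c ((k : ℝ) + 1) ω| ≤
      ((k : ℝ) + 1) ^ (-(2 * c)) * (unitIncrement T k ω + 2) := by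
  have hk : (0 : ℝ) ≤ k := k.cast_nonneg
  lift A to ℝ≥0 using by linarith
  have hU : (((k + 1 : ℕ) : ℝ≥0) : ℝ) = (k : ℝ) + 1 := by push_cast; rfl
  have hle : ((k + 1 : ℕ) : ℝ≥0) ≤ A := by rw [← NNReal.coe_le_coe, hU]; exact h1
  have hle2 : A ≤ ((k + 2 : ℕ) : ℝ≥0) := by rw [← NNReal.coe_le_coe]; push_cast; exact h2
  have hb := truncIntegral_sub_bounds hpos hmono htop (U := (k + 1 : ℕ)) (by positivity) hle hc0 hc
  rw [hU] at hb
  have hcnt : ((count T A ω - count T (k + 1 : ℕ) ω : ℕ) : ℝ) ≤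
      ((count T (k + 2 : ℕ) ω - count T (k + 1 : ℕ) ω : ℕ) : ℝ) := by
    exact_mod_cast Nat.sub_le_sub_right (count_mono hmono htop hle2) _
  have hu0 : 0 ≤ ((k : ℝ) + 1) ^ (-(2 * c)) := by positivity
  have hA0 : 0 ≤ (A : ℝ) ^ (-(2 * c)) := by positivity
  have hn0 := Nat.cast_nonneg (α := ℝ) (count T A ω - count T (k + 1 : ℕ) ω)
  rw [abs_le, unitIncrement]
  constructor
  · refine le_trans ?_ hb.1
    nlinarith [mul_nonneg hn0 hA0, mul_le_mul_of_nonneg_right hcnt hu0, mul_nonneg hn0 hu0,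
      mul_nonneg (by linarith : (0 : ℝ) ≤ k + 2 - A) hu0]
  · refine hb.2.trans ?_
    nlinarith [mul_le_mul_of_nonneg_right hcnt hu0,
      mul_nonneg (by linarith : (0 : ℝ) ≤ A - (k + 1)) hA0]

lemma abs_truncIntegral_sub_sub_le (hpos : ∀ j, 0 < T j ω) (hmono : StrictMono fun j => T j ω)
    (htop : Tendsto (fun j => T j ω) atTop atTop) {c : ℝ} (hc0 : 1 / 4 ≤ c) (hc : c < 1 / 2)
    (k : ℕ) :
    |truncIntegral T c ((k : ℝ) + 1 + 1) ω - truncIntegral T c ((k : ℝ) + 1) ω -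
      ((k : ℝ) + 1) ^ (-(2 * c)) * unitIncrement T k ω| ≤
      ((k : ℝ) + 1) ^ (-(3 / 2) : ℝ) * (unitIncrement T k ω + 2) := by
  have hk : (0 : ℝ) ≤ k := k.cast_nonneg
  have hU : (((k + 1 : ℕ) : ℝ≥0) : ℝ) = (k : ℝ) + 1 := by push_cast; rfl
  have hV : (((k + 2 : ℕ) : ℝ≥0) : ℝ) = (k : ℝ) + 1 + 1 := by push_cast; ring
  have hb := truncIntegral_sub_bounds hpos hmono htop (U := (k + 1 : ℕ)) (V := (k + 2 : ℕ))
    (by positivity) (by exact_mod_cast Nat.le_succ _) (by linarith) hc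
  rw [hU, hV] at hb
  have hr := rpow_neg_sub_rpow_neg_le (N := (k : ℝ) + 1) (x := 2 * c) (by linarith) (by linarith)
    (by linarith)
  have hmul := mul_le_mul_of_nonneg_right hr (unitIncrement_add_two_pos (T := T) (ω := ω) k).le
  refine le_trans ?_ hmul
  have hanti : ((k : ℝ) + 1 + 1) ^ (-(2 * c)) ≤ ((k : ℝ) + 1) ^ (-(2 * c)) :=
    Real.rpow_le_rpow_of_nonpos (by positivity) (by linarith) (by linarith)
  rw [abs_le, unitIncrement]
  constructor
  · linarith [hb.1]
  · linarith [hb.2, mul_nonneg (Nat.cast_nonneg (α := ℝ)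
      (count T (k + 2 : ℕ) ω - count T (k + 1 : ℕ) ω)) (sub_nonneg.2 hanti)]

/-- The truncated integrals converge when the Dirichlet series of the unit increments does, and
their limit is bounded below in terms of its sum, uniformly in `c`. -/
lemma exists_tendsto_truncIntegral (hpos : ∀ j, 0 < T j ω) (hmono : StrictMono fun j => T j ω)
    (htop : Tendsto (fun j => T j ω) atTop atTop)
    (hsum : Summable fun k : ℕ => ((k : ℝ) + 1) ^ (-(3 / 2) : ℝ) * (unitIncrement T k ω + 2))
    {c S : ℝ} (hc : c ∈ Ioo (1 / 4 : ℝ) (1 / 2))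
    (hS : Tendsto (fun n => ∑ k ∈ Finset.range n, ((k : ℝ) + 1) ^ (-(2 * c)) *
      unitIncrement T k ω) atTop (𝓝 S)) :
    ∃ L, Tendsto (fun A => truncIntegral T c A ω) atTop (𝓝 L) ∧
      S - ∑' k : ℕ, ((k : ℝ) + 1) ^ (-(3 / 2) : ℝ) * (unitIncrement T k ω + 2)
        - 1 / (1 - 2 * c) ≤ L := by
  obtain ⟨hc1, hc2⟩ := hc
  have hc0 : 0 ≤ c := by linarith
  -- `e k` is the cost of freezing the kernel at `k + 1`; summing it telescopes the integral into
  -- its part over `(0, 1]`, these errors and the Dirichlet series.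
  set e : ℕ → ℝ := fun k => truncIntegral T c ((k : ℝ) + 1 + 1) ω -
    truncIntegral T c ((k : ℝ) + 1) ω - ((k : ℝ) + 1) ^ (-(2 * c)) * unitIncrement T k ω with he
  have hele (k : ℕ) := abs_truncIntegral_sub_sub_le hpos hmono htop hc1.le hc2 k
  have hes : Summable e := hsum.of_norm_bounded hele
  have htel (n : ℕ) : truncIntegral T c ((n : ℝ) + 1) ω = truncIntegral T c 1 ω +
      (∑ k ∈ Finset.range n, e k +
        ∑ k ∈ Finset.range n, ((k : ℝ) + 1) ^ (-(2 * c)) * unitIncrement T k ω) := by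
    rw [← Finset.sum_add_distrib]
    have := Finset.sum_range_sub (fun k : ℕ => truncIntegral T c ((k : ℝ) + 1) ω) n
    simp only [Nat.cast_add, Nat.cast_one, Nat.cast_zero, zero_add] at this
    simp only [he, sub_add_cancel, this]
    ring
  set L := truncIntegral T c 1 ω + (∑' k, e k + S) with hL
  have hint : Tendsto (fun n : ℕ => truncIntegral T c ((n : ℝ) + 1) ω) atTop (𝓝 L) := by
    simp_rw [htel]
    exact (hes.hasSum.tendsto_sum_nat.add hS).const_add _
  have hterm : Tendsto (fun k : ℕ => ((k : ℝ) + 1) ^ (-(2 * c)) * (unitIncrement T k ω + 2))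
      atTop (𝓝 0) := by
    have h1 : Tendsto (fun k : ℕ => ((k : ℝ) + 1) ^ (-(2 * c)) * unitIncrement T k ω)
        atTop (𝓝 0) := by
      have := ((tendsto_add_atTop_iff_nat 1).2 hS).sub hS
      simpa [Finset.sum_range_succ] using this
    have h2 : Tendsto (fun k : ℕ => ((k : ℝ) + 1) ^ (-(2 * c))) atTop (𝓝 0) :=
      (tendsto_rpow_neg_atTop (by linarith)).comp
        (tendsto_natCast_atTop_atTop.atTop_add tendsto_const_nhds)
    have := h1.add (h2.mul_const 2)
    simpa [mul_add] using this
  have hfl : Tendsto (fun A : ℝ => ⌊A - 1⌋₊) atTop atTop :=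
    tendsto_nat_floor_atTop.comp (tendsto_atTop_add_const_right _ (-1) tendsto_id)
  have hdiff : Tendsto (fun A : ℝ => truncIntegral T c A ω -
      truncIntegral T c ((⌊A - 1⌋₊ : ℝ) + 1) ω) atTop (𝓝 0) := by
    refine squeeze_zero_norm' ?_ (hterm.comp hfl)
    filter_upwards [eventually_ge_atTop 1] with A hA
    refine abs_truncIntegral_sub_le hpos hmono htop hc0 hc2 _ ?_ ?_
    · linarith [Nat.floor_le (by linarith : 0 ≤ A - 1)]
    · linarith [Nat.lt_floor_add_one (A - 1)]
  refine ⟨L, ?_, ?_⟩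
  · simpa using hdiff.add (hint.comp hfl)
  · have h1 := neg_le_truncIntegral_one hpos hmono htop hc2
    have h2 : -∑' k : ℕ, ((k : ℝ) + 1) ^ (-(3 / 2) : ℝ) * (unitIncrement T k ω + 2) ≤
        ∑' k, e k := by
      rw [← tsum_neg]
      exact hsum.neg.tsum_le_tsum (fun k => (abs_le.1 (hele k)).1) hes
    linarith

/-- The terms are nonnegative, so convergence of the partial sums is already summability. -/
lemma summable_mul_unitIncrement_add_two {l : ℝ}
    (h : Tendsto (fun n => ∑ k ∈ Finset.range n, ((k : ℝ) + 1) ^ (-(3 / 2) : ℝ) *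
      unitIncrement T k ω) atTop (𝓝 l)) :
    Summable fun k : ℕ => ((k : ℝ) + 1) ^ (-(3 / 2) : ℝ) * (unitIncrement T k ω + 2) := by
  have hp : Summable fun k : ℕ => ((k : ℝ) + 1) ^ (-(3 / 2) : ℝ) := by
    have := (summable_nat_add_iff 1).2 (Real.summable_nat_rpow.2 (by norm_num : -(3 / 2 : ℝ) < -1))
    simpa using this
  refine ⟨_, (hasSum_iff_tendsto_nat_of_nonneg (fun k => mul_nonneg (by positivity)
    (unitIncrement_add_two_pos k).le) (l + ∑' k : ℕ, ((k : ℝ) + 1) ^ (-(3 / 2) : ℝ) * 2)).2 ?_⟩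
  simp_rw [mul_add, Finset.sum_add_distrib]
  exact h.add (hp.mul_right 2).hasSum.tendsto_sum_nat

end Deterministic

/-! ### Convergence of `H` and decay of `f` -/

section Conclusion

variable [MeasurableSpace Ω] {P : Measure Ω} {T : ℕ → Ω → ℝ}

lemma IsPoissonPoints.ae_exists_tendsto_truncIntegral [IsProbabilityMeasure P]
    (hT : IsPoissonPoints P (1 / 2) T) :
    ∀ᵐ ω ∂P, ∀ c ∈ Ioo (1 / 4 : ℝ) (1 / 2),
      ∃ h : ℝ, Tendsto (fun A : ℝ => truncIntegral T c A ω) atTop (𝓝 h) := by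
  obtain ⟨b, K, Y, hb, hY, hYT⟩ := exists_isNoise_ae_eq_unitIncrement hT
  filter_upwards [hT.pos, hT.strictMono, hT.tendsto_atTop, hY.ae_forall_exists_tendsto, hYT]
    with ω hpos hmono htop hconv hYω c hc
  simp_rw [hYω] at hconv
  obtain ⟨S, hS⟩ := hconv (2 * c) (by linarith [hc.1])
  obtain ⟨l, hl⟩ := hconv (3 / 2) (by norm_num)
  obtain ⟨L, hL, -⟩ := exists_tendsto_truncIntegral hpos hmono htop
    (summable_mul_unitIncrement_add_two hl) hc hS
  exact ⟨L, hL⟩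

/-- Almost surely `H` dominates, up to a random constant, a sequence of random variables that is
unbounded above, along a deterministic sequence of arguments tending to `1 / 4`. -/
lemma IsPoissonPoints.exists_seq_le_H [IsProbabilityMeasure P]
    (hT : IsPoissonPoints P (1 / 2) T) :
    ∃ (c : ℕ → ℝ) (Z : ℕ → Ω → ℝ), (∀ n : ℕ, c n ∈ Ioo (1 / 4 : ℝ) (1 / 4 + 1 / ((n : ℝ) + 8))) ∧
      (∀ n, AEMeasurable (Z n) P) ∧ (∀ᵐ ω ∂P, ∀ n, Z n ω ≤ H T (c n) ω) ∧
      ∀ᵐ ω ∂P, ∃ᶠ n in atTop, 0 ≤ Z n ω := by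
  obtain ⟨b, K, Y, hb, hY, hYT⟩ := exists_isNoise_ae_eq_unitIncrement hT
  obtain ⟨s, S, hs, hSm, hlim, hU⟩ := hY.exists_seq_ae_unbounded hb
  set D : Ω → ℝ := fun ω => ∑' k : ℕ, ((k : ℝ) + 1) ^ (-(3 / 2) : ℝ) * (Y k ω + 2)
  have hsum : ∀ᵐ ω ∂P, Summable fun k : ℕ => ((k : ℝ) + 1) ^ (-(3 / 2) : ℝ) * (Y k ω + 2) := by
    filter_upwards [hY.ae_forall_exists_tendsto, hYT] with ω hconv hYω
    obtain ⟨l, hl⟩ := hconv (3 / 2) (by norm_num)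
    simp_rw [hYω] at hl ⊢
    exact summable_mul_unitIncrement_add_two hl
  have hDm : AEMeasurable D P := by
    refine aemeasurable_of_tendsto_metrizable_ae atTop (f := fun n ω => ∑ k ∈ Finset.range n,
      ((k : ℝ) + 1) ^ (-(3 / 2) : ℝ) * (Y k ω + 2)) (fun n => ?_)
      (hsum.mono fun ω hω => hω.hasSum.tendsto_sum_nat)
    exact (Finset.measurable_fun_sum _ fun k _ =>
      ((hY.measurable k).add_const 2).const_mul _).aemeasurable
  have hs34 (n : ℕ) : s n < 3 / 4 := by
    refine (hs n).2.trans_le ?_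
    have : 1 / ((n : ℝ) + 4) ≤ 1 / 4 :=
      one_div_le_one_div_of_le (by norm_num) (by linarith [n.cast_nonneg (α := ℝ)])
    linarith
  -- `D` absorbs the kernel errors, and `4` bounds the contribution `1/(1 - 2c)` of `(0, 1]`, since
  -- `2c = s n < 3/4`.
  refine ⟨fun n => s n / 2, fun n ω => S n ω - D ω - 4, fun n => ⟨?_, ?_⟩,
    fun n => ((hSm n).sub hDm).sub_const 4, ?_, ?_⟩
  · linarith [(hs n).1]
  · have h1 : 1 / ((n : ℝ) + 4) / 2 ≤ 1 / ((n : ℝ) + 8) := by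
      rw [div_div]
      exact one_div_le_one_div_of_le (by positivity) (by linarith [n.cast_nonneg (α := ℝ)])
    linarith [(hs n).2]
  · filter_upwards [hT.pos, hT.strictMono, hT.tendsto_atTop, hlim, hsum, hYT]
      with ω hpos hmono htop hlimω hsumω hYω n
    have hlimn := hlimω n
    simp only [D, hYω] at hlimn hsumω ⊢
    have e : s n = 2 * (s n / 2) := by ring
    rw [e] at hlimn
    obtain ⟨L, hL, hle⟩ := exists_tendsto_truncIntegral hpos hmono htop hsumω
      (c := s n / 2) ⟨by linarith [(hs n).1], by linarith [hs34 n]⟩ hlimn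
    have h4 : 1 / (1 - 2 * (s n / 2)) ≤ 4 := by
      rw [div_le_iff₀ (by linarith [hs34 n])]
      linarith [hs34 n]
    rw [H, hL.limUnder_eq]
    linarith
  · filter_upwards [hU] with ω hω
    exact (hω (D ω + 4)).mono fun n hn => by linarith

/-- The event in `f` involves uncountably many `c` and need not be measurable; only monotonicity of
the measure is applied to it, against finite intersections of the events `Z n < 0`. -/
lemma IsPoissonPoints.tendsto_f [IsProbabilityMeasure P] (hT : IsPoissonPoints P (1 / 2) T)
    {c₂ : ℝ} (hc₂ : 1 / 4 < c₂) :
    Tendsto (fun c₁ : ℝ => f P T c₁ c₂) (𝓝[>] (1 / 4)) (𝓝 0) := by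
  obtain ⟨c, Z, hc, hZm, hZH, hfreq⟩ := hT.exists_seq_le_H
  obtain ⟨n₀, hn₀⟩ := exists_nat_one_div_lt (sub_pos.2 hc₂)
  have hcn (n : ℕ) (hn : n₀ ≤ n) : c n ≤ c₂ := by
    have h1 : 1 / ((n : ℝ) + 8) ≤ 1 / ((n₀ : ℝ) + 1) := by
      have : (n₀ : ℝ) ≤ n := by exact_mod_cast hn
      exact one_div_le_one_div_of_le (by positivity) (by linarith)
    linarith [(hc n).2]
  have hc12 (n : ℕ) : c n ≠ 1 / 2 := by
    have : 1 / ((n : ℝ) + 8) ≤ 1 / 8 :=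
      one_div_le_one_div_of_le (by norm_num) (by linarith [n.cast_nonneg (α := ℝ)])
    linarith [(hc n).2]
  set A : ℕ → Set Ω := fun m => ⋂ n ∈ Icc n₀ m, {ω | Z n ω < 0}
  have hAm (m : ℕ) : NullMeasurableSet (A m) P :=
    NullMeasurableSet.biInter (to_countable _) fun n _ =>
      nullMeasurableSet_lt (hZm n) aemeasurable_const
  have hanti : Antitone A := fun i j hij =>
    biInter_subset_biInter_left (Icc_subset_Icc_right hij)
  have hnull : P (⋂ m, A m) = 0 := by
    refine measure_mono_null ?_ (ae_iff.1 hfreq)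
    intro ω hω hfr
    obtain ⟨n, hn, hZ⟩ := (frequently_atTop.1 hfr) n₀
    have h1 := mem_iInter₂.1 (mem_iInter.1 hω n) n ⟨hn, le_rfl⟩
    exact absurd h1 (not_lt.2 hZ)
  have hlim : Tendsto (fun m => P.real (A m)) atTop (𝓝 0) := by
    have h1 := tendsto_measure_iInter_atTop hAm hanti ⟨0, measure_ne_top _ _⟩
    rw [hnull] at h1
    exact (ENNReal.tendsto_toReal ENNReal.zero_ne_top).comp h1
  have hbound (m : ℕ) : ∀ᶠ c₁ in 𝓝[>] (1 / 4 : ℝ), f P T c₁ c₂ ≤ P.real (A m) := by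
    have h1 : ∀ᶠ c₁ in 𝓝[>] (1 / 4 : ℝ), ∀ n ∈ Finset.range (m + 1), c₁ < c n :=
      (Finset.eventually_all _).2 fun n _ =>
        nhdsWithin_le_nhds (eventually_lt_nhds (hc n).1)
    filter_upwards [h1] with c₁ hc₁
    refine ENNReal.toReal_mono (measure_ne_top _ _) (measure_mono_ae ?_)
    filter_upwards [hZH] with ω hω hneg
    refine mem_iInter₂.2 fun n hn => ?_
    have h2 : c₁ < c n := hc₁ n (Finset.mem_range.2 (Nat.lt_succ_of_le hn.2))
    exact (hω n).trans_lt (hneg (c n) ⟨⟨h2.le, hcn n hn.1⟩, hc12 n⟩)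
  refine tendsto_order.2 ⟨fun a ha => Eventually.of_forall fun c₁ =>
    ha.trans_le measureReal_nonneg, fun a ha => ?_⟩
  obtain ⟨m, hm⟩ := (hlim.eventually_lt_const ha).exists
  exact (hbound m).mono fun c₁ h => h.trans_lt hm

end Conclusion

end EpsteinPoisson

theorem corollary1p7 {Ω : Type*} [MeasurableSpace Ω] (P : Measure Ω) [IsProbabilityMeasure P]
    (T : ℕ → Ω → ℝ) (hT : EpsteinPoisson.IsPoissonPoints P (1 / 2) T) :
    (∀ᵐ ω ∂P, ∀ c ∈ Ioo (1 / 4 : ℝ) (1 / 2),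
      ∃ h : ℝ, Tendsto (fun A : ℝ => EpsteinPoisson.truncIntegral T c A ω) atTop (𝓝 h)) ∧
    ∀ c₂ ∈ Ioc (1 / 4 : ℝ) (1 / 2),
      Tendsto (fun c₁ : ℝ => EpsteinPoisson.f P T c₁ c₂) (𝓝[>] (1 / 4)) (𝓝 0) :=
  ⟨hT.ae_exists_tendsto_truncIntegral, fun _ hc₂ => hT.tendsto_f hc₂.1⟩
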